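/- For $s\in\mathbb C$ and $\Re z>0$ let $\Gamma(s,z)=\int_z^\infty t^{s-1}e^{-t}\,dt$ be the upper incomplete Gamma function, the integral being taken along the half-line $t=z+u$, $u>0$; complex powers are principal values. The function $\zeta(s)\Gamma(s/2)\pi^{-s/2}$ is meromorphic; the left-hand sides below are understood as literal products when $s\notin\{1,0,-2,-4,\dots\}$, and at the points $1,0,-2,-4,\dots$ (removable singularities of the left-hand sides) as the limits of these products. All series below converge absolutely. (1) For every $s\in\mathbb C$, $$s(s-1)\frac{\zeta(s)\Gamma(\frac s2)}{\pi^{s/2}}=1-s(1-s)\sum_{k=1}^\infty\left[\frac{\Gamma(\frac s2,k^2\pi)}{(k^2\pi)^{s/2}}+\frac{\Gamma(\frac{1-s}2,k^2\pi)}{(k^2\pi)^{(1-s)/2}}\right].$$ (2) More generally, for every $x\in\mathbb C$ with $\Re x>|\Im x|$ and every $s\in\mathbb C$, $$s(s-1)\frac{\zeta(s)\Gamma(\frac s2)}{\pi^{s/2}}=(1-s)x^s+s\,x^{s-1}+s(s-1)\sum_{k=1}^\infty\left[\frac{\Gamma(\frac s2,k^2x^2\pi)}{(k^2\pi)^{s/2}}+\frac{\Gamma(\frac{1-s}2,\frac{k^2\pi}{x^2})}{(k^2\pi)^{(1-s)/2}}\right].$$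 (3) For every $x\in\mathbb C$ with $\Re x>|\Im x|$ and every $s\in\mathbb C$, $$(2^s-1)(1-2^{1-s})\frac{\zeta(s)\Gamma(\frac s2)}{\pi^{s/2}}=\Upsilon_x(s)+\Upsilon_{1/x}(1-s),$$ where $$\Upsilon_x(s)=\sum_{k=0}^\infty\left[\frac{\Gamma\big(\frac s2,\frac{(4k+1)^2\pi x^2}4\big)}{\big(\frac{(4k+1)^2\pi}4\big)^{s/2}}-2\,\frac{\Gamma\big(\frac s2,\frac{(4k+2)^2\pi x^2}4\big)}{\big(\frac{(4k+2)^2\pi}4\big)^{s/2}}+\frac{\Gamma\big(\frac s2,\frac{(4k+3)^2\pi x^2}4\big)}{\big(\frac{(4k+3)^2\pi}4\big)^{s/2}}\right].$$ -/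

import Mathlib

open Filter Topology

noncomputable section

/-- The upper incomplete Gamma function `Γ(s, z) = ∫_z^∞ t^(s-1) e^(-t) dt`, the integral being
taken along the horizontal half-line `t = z + u`, `u > 0`, with the principal branch of
`t^(s-1)`. For real `z > 0` this is the usual integral over `(z, ∞)`; for `Re z > 0` the integral
converges for every complex `s`. -/
def upperGamma (s z : ℂ) : ℂ :=
  ∫ u in Set.Ioi (0 : ℝ), (z + (u : ℂ)) ^ (s - 1) * Complex.exp (-(z + (u : ℂ)))

/-- The product `ζ(s) Γ(s/2) / π^(s/2)`. -/
def zetaGamma (s : ℂ) : ℂ :=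
  riemannZeta s * Complex.Gamma (s / 2) / (Real.pi : ℂ) ^ (s / 2)

/-- `s` is neither the pole `1` of `ζ` nor one of the poles `0, -2, -4, …` of `Γ(s/2)`, that is,
`ζ(s) Γ(s/2)` is literally a product of two complex numbers. -/
def IsRegularPoint (s : ℂ) : Prop :=
  s ≠ 1 ∧ ∀ n : ℕ, s ≠ -(2 * (n : ℂ))

/-- The term, for the index `k`, of the series
`∑ Γ(s/2, k²x²π) / (k²π)^(s/2) + Γ((1-s)/2, k²π/x²) / (k²π)^((1-s)/2)`. -/
def gammaTerm (x s : ℂ) (k : ℕ) : ℂ :=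
  upperGamma (s / 2) ((k : ℂ) ^ 2 * x ^ 2 * Real.pi) / ((k : ℂ) ^ 2 * Real.pi) ^ (s / 2) +
    upperGamma ((1 - s) / 2) ((k : ℂ) ^ 2 * Real.pi / x ^ 2) /
      ((k : ℂ) ^ 2 * Real.pi) ^ ((1 - s) / 2)

/-- `Γ(s/2, m²πx²/4) / (m²π/4)^(s/2)`. -/
def upsilonPart (x s : ℂ) (m : ℕ) : ℂ :=
  upperGamma (s / 2) ((m : ℂ) ^ 2 * Real.pi * x ^ 2 / 4) /
    ((m : ℂ) ^ 2 * Real.pi / 4) ^ (s / 2)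

/-- The term, for the index `k ≥ 0`, of the series `Υ_x(s)`. -/
def upsilonTerm (x s : ℂ) (k : ℕ) : ℂ :=
  upsilonPart x s (4 * k + 1) - 2 * upsilonPart x s (4 * k + 2) + upsilonPart x s (4 * k + 3)

/-- The second-difference series `Υ_x(s)`. -/
def upsilon (x s : ℂ) : ℂ :=
  ∑' k : ℕ, upsilonTerm x s k

end

open MeasureTheory Set

/-! As a function of `x` on the convex sector `|Im x| < Re x`, each quotient `Γ(s/2, q x²) /
q^(s/2)` has derivative `-2 x^(s-1) exp(-q x²)`. Summing over `q = k²π` produces the theta function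
at `i x²`. In the sum of the series at `(x, s)` and at `(1/x, 1-s)`, the transformation of theta
under `x ↦ 1/x` cancels theta and leaves `x^(s-1) - x^(s-2)` (`hasDerivAt_gammaSeries`). So the
series minus explicit primitives is constant in `x`. At `x = 1` the constant is the entire function
`Λ₀(s)`, by splitting its Mellin integral at `t = 1` (`completedRiemannZeta₀_eq_gammaSeries_one`).

Multiplying by `s(s-1)` gives (2), and (1) is `x = 1`. For (3), the series at `x/2`, `x`, `2x` are
combined with coefficients `2^s`, `-3`, `2^(1-s)`, which sum to `(2^s-1)(1-2^(1-s))` and kill the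
boundary terms. Exceptional `s` follow by continuity of the right-hand sides. -/

/-! ### Bounds and derivative of the incomplete Gamma function -/

theorem Real.exists_rpow_le_mul_exp (σ : ℝ) {δ c : ℝ} (hδ : 0 < δ) (hc : 0 < c) :
    ∃ C : ℝ, 0 ≤ C ∧ ∀ r : ℝ, δ ≤ r → r ^ σ ≤ C * Real.exp (c * r) := by
  obtain ⟨n, hn⟩ := exists_nat_ge σ
  refine ⟨δ ^ σ * (n.factorial / (c * δ) ^ n), by positivity, fun r hr => ?_⟩
  have hr0 : 0 < r := hδ.trans_le hr
  have h1 : (r / δ) ^ σ ≤ (r / δ) ^ n := by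
    rw [← Real.rpow_natCast]
    exact Real.rpow_le_rpow_of_exponent_le ((one_le_div hδ).2 hr) hn
  have h2 := Real.pow_div_factorial_le_exp (x := c * r) (by positivity) n
  have h3 : r ^ σ = δ ^ σ * (r / δ) ^ σ := by
    rw [← Real.mul_rpow hδ.le (by positivity), mul_div_cancel₀ _ hδ.ne']
  have h4 : (r / δ) ^ n = n.factorial / (c * δ) ^ n * ((c * r) ^ n / n.factorial) := by
    have : (n.factorial : ℝ) ≠ 0 := by positivity
    rw [mul_pow, mul_pow, div_pow]
    field_simp
  rw [h3, mul_assoc]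
  refine mul_le_mul_of_nonneg_left (h1.trans ?_) (by positivity)
  rw [h4]
  exact mul_le_mul_of_nonneg_left h2 (by positivity)

theorem Complex.norm_cpow_le_rpow_mul_exp (w a : ℂ) :
    ‖w ^ a‖ ≤ ‖w‖ ^ a.re * Real.exp (Real.pi * |a.im|) := by
  refine (Complex.norm_cpow_le w a).trans ?_
  rw [div_eq_mul_inv, ← Real.exp_neg]
  refine mul_le_mul_of_nonneg_left (Real.exp_le_exp.2 ?_) (by positivity)
  refine (neg_le_abs _).trans ?_
  rw [abs_mul]
  exact mul_le_mul_of_nonneg_right (Complex.abs_arg_le_pi w) (abs_nonneg _)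

/-- Half of the exponential decay absorbs the power. The constant is uniform over the cone `‖w‖ ≤ M
* w.re`, as domination and summation require. -/
theorem exists_norm_cpow_mul_exp_neg_le (a : ℂ) {δ : ℝ} (M : ℝ) (hδ : 0 < δ) :
    ∃ C : ℝ, 0 ≤ C ∧ ∀ w : ℂ, δ ≤ w.re → ‖w‖ ≤ M * w.re →
      ‖w ^ a * Complex.exp (-w)‖ ≤ C * Real.exp (-w.re / 2) := by
  obtain ⟨C, hC, h⟩ := Real.exists_rpow_le_mul_exp a.re hδ
    (c := 1 / (2 * max M 1)) (by positivity)
  refine ⟨C * Real.exp (Real.pi * |a.im|), by positivity, fun w hw hM => ?_⟩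
  have hre : w.re ≤ ‖w‖ := Complex.re_le_norm w
  have h1 := h ‖w‖ (hw.trans hre)
  have h2 : 1 / (2 * max M 1) * ‖w‖ ≤ w.re / 2 := by
    rw [one_div, inv_mul_le_iff₀ (by positivity)]
    have : M * w.re ≤ max M 1 * w.re :=
      mul_le_mul_of_nonneg_right (le_max_left _ _) (hδ.trans_le hw).le
    linarith
  rw [norm_mul, Complex.norm_exp, Complex.neg_re]
  calc ‖w ^ a‖ * Real.exp (-w.re)
      ≤ (C * Real.exp (w.re / 2) * Real.exp (Real.pi * |a.im|)) * Real.exp (-w.re) := by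
        refine mul_le_mul_of_nonneg_right ((Complex.norm_cpow_le_rpow_mul_exp w a).trans ?_)
          (by positivity)
        refine mul_le_mul_of_nonneg_right (h1.trans ?_) (by positivity)
        exact mul_le_mul_of_nonneg_left (Real.exp_le_exp.2 h2) hC
    _ = C * Real.exp (Real.pi * |a.im|) * (Real.exp (w.re / 2) * Real.exp (-w.re)) := by ring
    _ = C * Real.exp (Real.pi * |a.im|) * Real.exp (-w.re / 2) := by
        rw [← Real.exp_add]; ring_nf

theorem norm_add_ofReal_le_mul_re {z : ℂ} {M u : ℝ} (hM : ‖z‖ ≤ M * z.re) (hz : 0 < z.re)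
    (hu : 0 ≤ u) : ‖z + u‖ ≤ M * (z + u).re := by
  -- `M ≥ 1` is forced by `z.re ≤ ‖z‖`; hence the cone is stable under translation to the right.
  have h1 : 1 ≤ M := by
    by_contra h
    have := mul_lt_mul_of_pos_right (not_le.1 h) hz
    linarith [Complex.re_le_norm z]
  have h2 : ‖(u : ℂ)‖ = u := by simp [abs_of_nonneg hu]
  have h3 := norm_add_le z (u : ℂ)
  rw [h2] at h3
  simp only [Complex.add_re, Complex.ofReal_re]
  nlinarith

theorem integrableOn_exp_neg_add_div_two (r : ℝ) :
    IntegrableOn (fun u : ℝ => Real.exp (-(r + u) / 2)) (Ioi 0) := by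
  have h := (integrableOn_exp_mul_Ioi (a := -1 / 2) (by norm_num) 0).const_mul
    (Real.exp (-r / 2))
  refine IntegrableOn.congr_fun h (fun u _ => ?_) measurableSet_Ioi
  rw [← Real.exp_add]; ring_nf

theorem continuousOn_cpow_mul_exp_neg_add (a : ℂ) {z : ℂ} (hz : 0 < z.re) :
    ContinuousOn (fun u : ℝ => (z + u) ^ a * Complex.exp (-(z + u))) (Ici 0) := by
  intro u hu
  have h : (z + (u : ℂ)) ∈ Complex.slitPlane := Or.inl (by
    have : 0 ≤ u := hu
    simp only [Complex.add_re, Complex.ofReal_re]; linarith)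
  refine ContinuousAt.continuousWithinAt (ContinuousAt.mul ?_ (by fun_prop))
  exact ContinuousAt.cpow (by fun_prop) continuousAt_const h

theorem norm_upperGamma_integrand_le {a z : ℂ} {δ M C : ℝ}
    (hC : ∀ w : ℂ, δ ≤ w.re → ‖w‖ ≤ M * w.re →
      ‖w ^ a * Complex.exp (-w)‖ ≤ C * Real.exp (-w.re / 2))
    (hδ : 0 < δ) (hz : δ ≤ z.re) (hM : ‖z‖ ≤ M * z.re) {u : ℝ} (hu : 0 < u) :
    ‖(z + u) ^ a * Complex.exp (-(z + u))‖ ≤ C * Real.exp (-(z.re + u) / 2) := by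
  have := hC (z + u) (by simp; linarith)
    (norm_add_ofReal_le_mul_re hM (hδ.trans_le hz) hu.le)
  simpa using this

theorem integrableOn_upperGamma_integrand (a : ℂ) {z : ℂ} (hz : 0 < z.re) :
    IntegrableOn (fun u : ℝ => (z + u) ^ a * Complex.exp (-(z + u))) (Ioi 0) := by
  obtain ⟨C, -, hC⟩ := exists_norm_cpow_mul_exp_neg_le a (‖z‖ / z.re) hz
  refine Integrable.mono' ((integrableOn_exp_neg_add_div_two z.re).const_mul C) ?_ ?_
  · exact ((continuousOn_cpow_mul_exp_neg_add a hz).mono Ioi_subset_Ici_self).aestronglyMeasurable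
      measurableSet_Ioi
  · refine (ae_restrict_iff' measurableSet_Ioi).2 (Eventually.of_forall fun u hu => ?_)
    exact norm_upperGamma_integrand_le hC hz le_rfl (div_mul_cancel₀ _ hz.ne').ge hu

theorem exists_norm_upperGamma_le (s : ℂ) {δ : ℝ} (M : ℝ) (hδ : 0 < δ) :
    ∃ C : ℝ, 0 ≤ C ∧ ∀ z : ℂ, δ ≤ z.re → ‖z‖ ≤ M * z.re →
      ‖upperGamma s z‖ ≤ C * Real.exp (-z.re / 2) := by
  obtain ⟨C, hC0, hC⟩ := exists_norm_cpow_mul_exp_neg_le (s - 1) M hδ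
  refine ⟨C * ∫ u in Ioi (0 : ℝ), Real.exp (-(0 + u) / 2), ?_, fun z hz hM => ?_⟩
  · exact mul_nonneg hC0 (integral_nonneg fun u => (Real.exp_pos _).le)
  · rw [upperGamma]
    refine (norm_integral_le_of_norm_le
      ((integrableOn_exp_neg_add_div_two z.re).const_mul C) ?_).trans ?_
    · refine (ae_restrict_iff' measurableSet_Ioi).2 (Eventually.of_forall fun u hu => ?_)
      exact norm_upperGamma_integrand_le hC hδ hz hM hu
    · rw [integral_const_mul, mul_assoc, ← integral_mul_const]
      refine le_of_eq ?_
      congr 2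
      ext u
      rw [← Real.exp_add]; ring_nf

theorem tendsto_upperGamma_integrand (a : ℂ) {z : ℂ} (hz : 0 < z.re) :
    Tendsto (fun u : ℝ => (z + u) ^ a * Complex.exp (-(z + u))) atTop (𝓝 0) := by
  obtain ⟨C, -, hC⟩ := exists_norm_cpow_mul_exp_neg_le a (‖z‖ / z.re) hz
  have h1 : Tendsto (fun u : ℝ => C * Real.exp (-(z.re + u) / 2)) atTop (𝓝 (C * 0)) := by
    refine Tendsto.const_mul C (Real.tendsto_exp_atBot.comp ?_)
    have : Tendsto (fun u : ℝ => -((z.re + u) / 2)) atTop atBot :=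
      tendsto_neg_atTop_atBot.comp
        ((tendsto_atTop_add_const_left atTop z.re tendsto_id).atTop_div_const two_pos)
    simpa only [neg_div] using this
  rw [mul_zero] at h1
  refine squeeze_zero_norm' ?_ h1
  filter_upwards [eventually_gt_atTop (0 : ℝ)] with u hu
  exact norm_upperGamma_integrand_le hC hz le_rfl (div_mul_cancel₀ _ hz.ne').ge hu

theorem hasDerivAt_cpow_mul_exp_neg (a : ℂ) {w : ℂ} (hw : 0 < w.re) :
    HasDerivAt (fun w : ℂ => w ^ a * Complex.exp (-w))
      (a * (w ^ (a - 1) * Complex.exp (-w)) - w ^ a * Complex.exp (-w)) w := by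
  have h1 := (hasDerivAt_id w).cpow_const (c := a) (Or.inl hw)
  have h2 := (hasDerivAt_neg w).cexp
  refine (h1.mul h2).congr_deriv ?_
  simp only [id]
  ring

/-- The integrand depends only on `z + u`, so its `z`-derivative is its `u`-derivative, and the
differentiated integral is minus the value at `u = 0`. -/
theorem hasDerivAt_upperGamma (s : ℂ) {z : ℂ} (hz : 0 < z.re) :
    HasDerivAt (upperGamma s) (-(z ^ (s - 1) * Complex.exp (-z))) z := by
  have hδ : 0 < z.re / 2 := by positivity
  set δ := z.re / 2 with hδ'
  -- On the ball of radius `δ`, `‖y‖ ≤ ‖z‖ + δ` and `y.re ≥ δ`, so this `M` puts the ball inside one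
  -- cone.
  set M := (‖z‖ + δ) / δ with hM'
  obtain ⟨C₁, hC₁0, hC₁⟩ := exists_norm_cpow_mul_exp_neg_le (s - 1) M hδ
  obtain ⟨C₂, hC₂0, hC₂⟩ := exists_norm_cpow_mul_exp_neg_le (s - 1 - 1) M hδ
  have hball : ∀ y ∈ Metric.ball z δ, δ ≤ y.re ∧ ‖y‖ ≤ M * y.re := by
    intro y hy
    rw [Metric.mem_ball, dist_eq_norm] at hy
    have h1 : |(y - z).re| ≤ ‖y - z‖ := Complex.abs_re_le_norm _
    have h2 : δ ≤ y.re := by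
      have := (abs_le.1 h1).1
      simp only [Complex.sub_re] at this
      linarith
    refine ⟨h2, ?_⟩
    have h3 : ‖y‖ ≤ ‖z‖ + δ := by
      have := norm_add_le z (y - z)
      rw [add_sub_cancel] at this
      linarith
    refine h3.trans ?_
    rw [hM', div_mul_eq_mul_div, le_div_iff₀ hδ]
    exact mul_le_mul_of_nonneg_left h2 (by positivity)
  have hpos : ∀ y ∈ Metric.ball z δ, ∀ u : ℝ, 0 ≤ u → 0 < (y + u).re := by
    intro y hy u hu
    have := (hball y hy).1
    simp only [Complex.add_re, Complex.ofReal_re]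
    linarith
  have hzb : z ∈ Metric.ball z δ := Metric.mem_ball_self hδ
  have hint' : IntegrableOn (fun u : ℝ => (s - 1) * ((z + u) ^ (s - 1 - 1) *
      Complex.exp (-(z + u))) - (z + u) ^ (s - 1) * Complex.exp (-(z + u))) (Ioi 0) :=
    ((integrableOn_upperGamma_integrand (s - 1 - 1) hz).const_mul _).sub
      (integrableOn_upperGamma_integrand (s - 1) hz)
  have key := hasDerivAt_integral_of_dominated_loc_of_deriv_le
    (μ := volume.restrict (Ioi (0 : ℝ)))
    (F := fun (y : ℂ) (u : ℝ) => (y + u) ^ (s - 1) * Complex.exp (-(y + u)))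
    (F' := fun (y : ℂ) (u : ℝ) => (s - 1) * ((y + u) ^ (s - 1 - 1) * Complex.exp (-(y + u)))
      - (y + u) ^ (s - 1) * Complex.exp (-(y + u)))
    (bound := fun u : ℝ => (‖s - 1‖ * C₂ + C₁) * Real.exp (-(δ + u) / 2))
    (Metric.ball_mem_nhds z hδ) ?_ (integrableOn_upperGamma_integrand (s - 1) hz)
    hint'.aestronglyMeasurable ?_
    ((integrableOn_exp_neg_add_div_two δ).const_mul _) ?_
  · refine key.2.congr_deriv ?_
    have h := integral_Ioi_of_hasDerivAt_of_tendsto (a := (0 : ℝ))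
      (((continuousOn_cpow_mul_exp_neg_add (s - 1) hz) 0 self_mem_Ici))
      (fun u hu => ?_) hint' (tendsto_upperGamma_integrand (s - 1) hz)
    · rw [h]; simp
    · have := (hasDerivAt_cpow_mul_exp_neg (s - 1) (hpos z hzb u (le_of_lt hu)))
      exact (this.comp_const_add z (u : ℂ)).comp_ofReal
  · filter_upwards [Metric.ball_mem_nhds z hδ] with y hy
    exact (integrableOn_upperGamma_integrand (s - 1)
      (hδ.trans_le (hball y hy).1)).aestronglyMeasurable
  · refine (ae_restrict_iff' measurableSet_Ioi).2 (Eventually.of_forall fun u hu y hy => ?_)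
    obtain ⟨hy1, hy2⟩ := hball y hy
    have hu' : (0 : ℝ) < u := hu
    have e : Real.exp (-(y.re + u) / 2) ≤ Real.exp (-(δ + u) / 2) :=
      Real.exp_le_exp.2 (by linarith)
    have b1 := (norm_upperGamma_integrand_le hC₁ hδ hy1 hy2 hu').trans
      (mul_le_mul_of_nonneg_left e hC₁0)
    have b2 := (norm_upperGamma_integrand_le hC₂ hδ hy1 hy2 hu').trans
      (mul_le_mul_of_nonneg_left e hC₂0)
    refine (norm_sub_le _ _).trans ?_
    rw [norm_mul (s - 1), add_mul, mul_assoc]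
    exact add_le_add (mul_le_mul_of_nonneg_left b2 (norm_nonneg _)) b1
  · refine (ae_restrict_iff' measurableSet_Ioi).2 (Eventually.of_forall fun u hu y hy => ?_)
    exact (hasDerivAt_cpow_mul_exp_neg (s - 1) (hpos y hy u (le_of_lt hu))).comp_add_const y (u : ℂ)

/-! ### The quotients and their parameters -/

/-- `Γ(s/2, q x²) / q^(s/2)`. -/
noncomputable def gammaQuotient (x s : ℂ) (q : ℝ) : ℂ :=
  upperGamma (s / 2) (q * x ^ 2) / (q : ℂ) ^ (s / 2)

/-- The number `(k + 1)² π`. -/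
noncomputable def sqMulPi (k : ℕ) : ℝ :=
  ((k + 1 : ℕ) : ℝ) ^ 2 * Real.pi

theorem pi_le_sqMulPi (k : ℕ) : Real.pi ≤ sqMulPi k := by
  rw [sqMulPi]
  have : (1 : ℝ) ≤ ((k + 1 : ℕ) : ℝ) ^ 2 := one_le_pow₀ (by
    push_cast; linarith [Nat.cast_nonneg (α := ℝ) k])
  nlinarith [Real.pi_pos]

theorem sqMulPi_pos (k : ℕ) : 0 < sqMulPi k :=
  Real.pi_pos.trans_le (pi_le_sqMulPi k)

theorem natCast_le_sqMulPi (k : ℕ) : (k : ℝ) ≤ sqMulPi k := by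
  rw [sqMulPi]
  have h : (0 : ℝ) ≤ k := Nat.cast_nonneg k
  push_cast
  nlinarith [Real.pi_gt_three, sq_nonneg (k : ℝ)]

theorem summable_exp_neg_mul_sqMulPi {c : ℝ} (hc : 0 < c) :
    Summable fun k => Real.exp (-(c * sqMulPi k)) := by
  refine Summable.of_nonneg_of_le (fun k => (Real.exp_pos _).le) (fun k => ?_)
    (Real.summable_exp_nat_mul_iff.2 (neg_neg_of_pos hc))
  refine Real.exp_le_exp.2 ?_
  nlinarith [natCast_le_sqMulPi k]

/-! ### Differentiation in `x` on the sector, and the theta function -/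

section Sector

variable {x : ℂ}

theorem re_pos_of_abs_im_lt_re (hx : |x.im| < x.re) : 0 < x.re :=
  (abs_nonneg _).trans_lt hx

theorem ne_zero_of_abs_im_lt_re (hx : |x.im| < x.re) : x ≠ 0 := by
  rintro rfl
  simp at hx

theorem sq_re_pos_of_abs_im_lt_re (hx : |x.im| < x.re) : 0 < (x ^ 2).re := by
  have h := sq_lt_sq' (by linarith [neg_abs_le x.im, abs_nonneg x.im, le_abs_self x.im]) hx
  rw [sq_abs] at h
  simp only [sq, Complex.mul_re] at h ⊢
  linarith

theorem abs_im_inv_lt_re_inv (hx : |x.im| < x.re) : |(1 / x).im| < (1 / x).re := by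
  have h : 0 < Complex.normSq x := Complex.normSq_pos.2 (ne_zero_of_abs_im_lt_re hx)
  rw [one_div, Complex.inv_re, Complex.inv_im, abs_div, abs_neg, abs_of_pos h]
  exact div_lt_div_of_pos_right hx h

theorem abs_im_ofReal_mul_lt (hx : |x.im| < x.re) {c : ℝ} (hc : 0 < c) :
    |((c : ℂ) * x).im| < ((c : ℂ) * x).re := by
  rw [Complex.re_ofReal_mul, Complex.im_ofReal_mul, abs_mul, abs_of_pos hc]
  exact mul_lt_mul_of_pos_left hx hc

/-- Since `|arg x| < π/2`, doubling the argument does not cross the branch cut. -/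
theorem log_ofReal_mul_sq (hx : 0 < x.re) {q : ℝ} (hq : 0 < q) :
    Complex.log (q * x ^ 2) = Complex.log q + 2 * Complex.log x := by
  have hx0 : x ≠ 0 := by rintro rfl; simp at hx
  have h := abs_lt.1 (Complex.abs_arg_lt_pi_div_two_iff.2 (Or.inl hx))
  rw [Complex.log_ofReal_mul hq (pow_ne_zero 2 hx0), Complex.ofReal_log hq.le, sq,
    Complex.log_mul hx0 hx0 ⟨by linarith, by linarith⟩, two_mul]

theorem ofReal_mul_sq_cpow (hx : 0 < x.re) {q : ℝ} (hq : 0 < q) (a : ℂ) :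
    ((q : ℂ) * x ^ 2) ^ a = (q : ℂ) ^ a * x ^ (2 * a) := by
  have hx0 : x ≠ 0 := by rintro rfl; simp at hx
  have hq0 : (q : ℂ) ≠ 0 := Complex.ofReal_ne_zero.2 hq.ne'
  rw [Complex.cpow_def_of_ne_zero (mul_ne_zero hq0 (pow_ne_zero 2 hx0)),
    Complex.cpow_def_of_ne_zero hq0, Complex.cpow_def_of_ne_zero hx0, log_ofReal_mul_sq hx hq,
    ← Complex.exp_add]
  ring_nf

theorem re_ofReal_mul_sq_pos (hx : |x.im| < x.re) {q : ℝ} (hq : 0 < q) :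
    0 < ((q : ℂ) * x ^ 2).re := by
  rw [Complex.re_ofReal_mul]
  exact mul_pos hq (sq_re_pos_of_abs_im_lt_re hx)

/-- All powers of `q` cancel, so `q` survives only in the exponential and the sum over `q` is a
theta series. -/
theorem hasDerivAt_gammaQuotient (hx : |x.im| < x.re) (s : ℂ) {q : ℝ} (hq : 0 < q) :
    HasDerivAt (fun x => gammaQuotient x s q)
      (-2 * x ^ (s - 1) * Complex.exp (-(q * x ^ 2))) x := by
  have h1 : HasDerivAt (fun x : ℂ => (q : ℂ) * x ^ 2) (q * (2 * x)) x := by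
    simpa using (hasDerivAt_pow 2 x).const_mul (q : ℂ)
  have h2 := ((hasDerivAt_upperGamma (s / 2) (re_ofReal_mul_sq_pos hx hq)).comp x h1).div_const
    ((q : ℂ) ^ (s / 2))
  refine h2.congr_deriv ?_
  have hx0 := ne_zero_of_abs_im_lt_re hx
  have hq0 : (q : ℂ) ≠ 0 := Complex.ofReal_ne_zero.2 hq.ne'
  have hqs : (q : ℂ) ^ (s / 2) ≠ 0 := by simp [Complex.cpow_eq_zero_iff, hq0]
  rw [ofReal_mul_sq_cpow (re_pos_of_abs_im_lt_re hx) hq, Complex.cpow_sub _ _ hq0,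
    show 2 * (s / 2 - 1) = s - 1 - 1 by ring, Complex.cpow_sub _ 1 hx0, Complex.cpow_one,
    Complex.cpow_one]
  field_simp

theorem summable_gammaQuotient (hx : |x.im| < x.re) (s : ℂ) :
    Summable fun k => gammaQuotient x s (sqMulPi k) := by
  have hρ := sq_re_pos_of_abs_im_lt_re hx
  set ρ := (x ^ 2).re with hρdef
  obtain ⟨C, hC0, hC⟩ := exists_norm_upperGamma_le (s / 2) (‖x ^ 2‖ / ρ)
    (mul_pos Real.pi_pos hρ)
  -- The incomplete Gamma factor decays like `exp(-ρq/2)`; spending `ρ/4` on the power of `q` leaves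
  -- `exp(-ρq/4)`.
  obtain ⟨D, hD0, hD⟩ := Real.exists_rpow_le_mul_exp (-(s / 2)).re Real.pi_pos
    (c := ρ / 4) (by positivity)
  refine Summable.of_norm_bounded ((summable_exp_neg_mul_sqMulPi
    (c := ρ / 4) (by positivity)).mul_left (C * D)) (fun k => ?_)
  have hq := sqMulPi_pos k
  have hqπ := pi_le_sqMulPi k
  set q := sqMulPi k
  have h1 := hC (q * x ^ 2) (by
    rw [Complex.re_ofReal_mul]; exact mul_le_mul_of_nonneg_right hqπ hρ.le) (by
    rw [Complex.re_ofReal_mul, norm_mul, Complex.norm_real, Real.norm_of_nonneg hq.le, ← hρdef]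
    field_simp
    exact le_rfl)
  rw [Complex.re_ofReal_mul, ← hρdef] at h1
  have h2 := hD q hqπ
  rw [gammaQuotient, div_eq_mul_inv, ← Complex.cpow_neg, norm_mul,
    Complex.norm_cpow_eq_rpow_re_of_pos hq]
  calc _ ≤ (C * Real.exp (-(q * ρ) / 2)) * (D * Real.exp (ρ / 4 * q)) :=
        mul_le_mul h1 h2 (by positivity) (by positivity)
    _ = C * D * (Real.exp (-(q * ρ) / 2) * Real.exp (ρ / 4 * q)) := by ring
    _ = C * D * Real.exp (-(ρ / 4 * q)) := by rw [← Real.exp_add]; ring_nf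

theorem hasSum_exp_neg_sqMulPi (hx : |x.im| < x.re) :
    HasSum (fun k => Complex.exp (-(sqMulPi k * x ^ 2)))
      ((jacobiTheta (Complex.I * x ^ 2) - 1) / 2) := by
  have h : 0 < (Complex.I * x ^ 2).im := by
    simpa only [Complex.I_mul_im] using sq_re_pos_of_abs_im_lt_re hx
  refine (hasSum_nat_jacobiTheta h).congr_fun fun k => ?_
  congr 1
  rw [sqMulPi]
  push_cast
  linear_combination (-(Real.pi : ℂ) * (k + 1) ^ 2 * x ^ 2) * Complex.I_sq

theorem jacobiTheta_I_mul_inv_sq (hx : |x.im| < x.re) :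
    jacobiTheta (Complex.I * (1 / x) ^ 2) = x * jacobiTheta (Complex.I * x ^ 2) := by
  have h : 0 < (Complex.I * x ^ 2).im := by
    simpa only [Complex.I_mul_im] using sq_re_pos_of_abs_im_lt_re hx
  have hx0 := ne_zero_of_abs_im_lt_re hx
  have key := jacobiTheta_S_smul ⟨Complex.I * x ^ 2, h⟩
  rw [UpperHalfPlane.modular_S_smul] at key
  have e1 : (-Complex.I * (Complex.I * x ^ 2)) ^ (1 / 2 : ℂ) = x := by
    rw [show -Complex.I * (Complex.I * x ^ 2) = ((1 : ℝ) : ℂ) * x ^ 2 by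
      push_cast; linear_combination (-x ^ 2) * Complex.I_sq,
      ofReal_mul_sq_cpow (re_pos_of_abs_im_lt_re hx) one_pos]
    norm_num
  have e2 : (-(Complex.I * x ^ 2))⁻¹ = Complex.I * (1 / x) ^ 2 := by
    rw [one_div, inv_pow, ← neg_mul, mul_inv, inv_neg, Complex.inv_I, neg_neg]
  change jacobiTheta (-(Complex.I * x ^ 2))⁻¹ =
    (-Complex.I * (Complex.I * x ^ 2)) ^ (1 / 2 : ℂ) * jacobiTheta (Complex.I * x ^ 2) at key
  rwa [e1, e2] at key

theorem hasDerivAt_tsum_gammaQuotient (hx : |x.im| < x.re) (s : ℂ) :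
    HasDerivAt (fun x => ∑' k, gammaQuotient x s (sqMulPi k))
      (x ^ (s - 1) * (1 - jacobiTheta (Complex.I * x ^ 2))) x := by
  have hρ := sq_re_pos_of_abs_im_lt_re hx
  have ev1 : ∀ᶠ y : ℂ in 𝓝 x, |y.im| < y.re :=
    (Continuous.continuousAt (by fun_prop)).eventually_lt
      (Complex.continuous_re.continuousAt) hx
  have ev2 : ∀ᶠ y : ℂ in 𝓝 x, (x ^ 2).re / 2 < (y ^ 2).re :=
    (Continuous.continuousAt (f := fun y : ℂ => (y ^ 2).re) (by fun_prop)).eventually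
      (lt_mem_nhds (half_lt_self hρ))
  have ev3 : ∀ᶠ y : ℂ in 𝓝 x, ‖-2 * y ^ (s - 1)‖ < ‖-2 * x ^ (s - 1)‖ + 1 := by
    have hc : ContinuousAt (fun y : ℂ => ‖-2 * y ^ (s - 1)‖) x :=
      (continuousAt_const.mul (continuousAt_id.cpow continuousAt_const
        (Or.inl (re_pos_of_abs_im_lt_re hx)))).norm
    exact hc.eventually (gt_mem_nhds (lt_add_one _))
  obtain ⟨ε, hε, hball⟩ := Metric.eventually_nhds_iff_ball.1 (ev1.and (ev2.and ev3))
  have key := hasDerivAt_tsum_of_isPreconnected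
    (g := fun k y => gammaQuotient y s (sqMulPi k))
    (g' := fun k y => -2 * y ^ (s - 1) * Complex.exp (-(sqMulPi k * y ^ 2)))
    ((summable_exp_neg_mul_sqMulPi (half_pos hρ)).mul_left (‖-2 * x ^ (s - 1)‖ + 1))
    Metric.isOpen_ball (convex_ball x ε).isPreconnected
    (fun k y hy => hasDerivAt_gammaQuotient (hball y hy).1 s (sqMulPi_pos k))
    (fun k y hy => ?_) (Metric.mem_ball_self hε) (summable_gammaQuotient hx s)
    (Metric.mem_ball_self hε)
  · refine key.congr_deriv ?_
    rw [tsum_mul_left, (hasSum_exp_neg_sqMulPi hx).tsum_eq]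
    ring
  · obtain ⟨-, hy2, hy3⟩ := hball y hy
    rw [norm_mul, Complex.norm_exp]
    refine mul_le_mul hy3.le (Real.exp_le_exp.2 ?_) (by positivity) (by positivity)
    rw [Complex.neg_re, Complex.re_ofReal_mul]
    nlinarith [sqMulPi_pos k]

/-- The series `∑ Γ(s/2, k²πx²) / (k²π)^(s/2) + ∑ Γ((1-s)/2, k²π/x²) / (k²π)^((1-s)/2)`. -/
noncomputable def gammaSeries (x s : ℂ) : ℂ :=
  (∑' k, gammaQuotient x s (sqMulPi k)) + ∑' k, gammaQuotient (1 / x) (1 - s) (sqMulPi k)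

/-- With `θ = jacobiTheta (I * x ^ 2)`, the second series contributes `-x^(s-2) (1 - xθ)`, whose
theta part cancels that of `x^(s-1) (1 - θ)`. -/
theorem hasDerivAt_gammaSeries (hx : |x.im| < x.re) (s : ℂ) :
    HasDerivAt (fun x => gammaSeries x s) (x ^ (s - 1) - x ^ (s - 1 - 1)) x := by
  have hx0 := ne_zero_of_abs_im_lt_re hx
  have h1 : HasDerivAt (fun x : ℂ => 1 / x) (-(x ^ 2)⁻¹) x := by
    simpa only [one_div] using hasDerivAt_inv hx0
  have h2 := (hasDerivAt_tsum_gammaQuotient (abs_im_inv_lt_re_inv hx) (1 - s)).comp x h1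
  refine ((hasDerivAt_tsum_gammaQuotient hx s).add h2).congr_deriv ?_
  have harg : x.arg ≠ Real.pi :=
    (Complex.mem_slitPlane_iff_arg.1 (Or.inl (re_pos_of_abs_im_lt_re hx))).1
  have e : (1 / x) ^ (1 - s - 1) = x ^ s := by
    rw [one_div, Complex.inv_cpow _ _ harg, ← Complex.cpow_neg]
    ring_nf
  rw [jacobiTheta_I_mul_inv_sq hx, e]
  simp only [Complex.cpow_sub _ _ hx0, Complex.cpow_one]
  field_simp
  ring

end Sector

/-! ### The value at `x = 1` as a Mellin transform -/

theorem one_lt_re_one : |(1 : ℂ).im| < (1 : ℂ).re := by simp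

theorem integrand_comp_mul (s : ℂ) {q : ℝ} (hq : 0 < q) {t : ℝ} (ht : 0 < t) :
    (q : ℂ) / (q : ℂ) ^ (s / 2) * (((q * t : ℝ) : ℂ) ^ (s / 2 - 1) *
      Complex.exp (-((q * t : ℝ) : ℂ))) = (t : ℂ) ^ (s / 2 - 1) * Complex.exp (-(q * t)) := by
  have hq0 : (q : ℂ) ≠ 0 := Complex.ofReal_ne_zero.2 hq.ne'
  have hqs : (q : ℂ) ^ (s / 2) ≠ 0 := by simp [Complex.cpow_eq_zero_iff, hq0]
  rw [Complex.ofReal_mul, Complex.mul_cpow_ofReal_nonneg hq.le ht.le,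
    Complex.cpow_sub _ 1 hq0, Complex.cpow_one]
  field_simp

theorem gammaQuotient_one_eq_integral (s : ℂ) {q : ℝ} (hq : 0 < q) :
    gammaQuotient 1 s q =
      ∫ t in Ioi (1 : ℝ), (t : ℂ) ^ (s / 2 - 1) * Complex.exp (-(q * t)) := by
  have h1 : upperGamma (s / 2) (q * 1 ^ 2) =
      ∫ v in Ioi q, ((v : ℂ) ^ (s / 2 - 1) * Complex.exp (-v)) := by
    rw [upperGamma, ← (measurePreserving_add_left volume q).setIntegral_preimage_emb
      (measurableEmbedding_addLeft q) (fun v : ℝ => (v : ℂ) ^ (s / 2 - 1) * Complex.exp (-v))]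
    simp
  have h2 := integral_comp_mul_left_Ioi'
    (fun v : ℝ => (v : ℂ) ^ (s / 2 - 1) * Complex.exp (-v)) 1 hq
  rw [mul_one] at h2
  rw [gammaQuotient, h1, ← h2, Complex.real_smul, mul_div_right_comm, ← integral_const_mul]
  refine setIntegral_congr_fun measurableSet_Ioi fun t ht => ?_
  exact integrand_comp_mul s hq (one_pos.trans ht)

theorem integrableOn_cpow_mul_exp_neg_mul (s : ℂ) {q : ℝ} (hq : 0 < q) :
    IntegrableOn (fun t : ℝ => (t : ℂ) ^ (s / 2 - 1) * Complex.exp (-(q * t))) (Ioi 1) := by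
  have h1 : IntegrableOn (fun v : ℝ => (v : ℂ) ^ (s / 2 - 1) * Complex.exp (-v)) (Ioi q) := by
    rw [← (measurePreserving_add_left volume q).integrableOn_comp_preimage
      (measurableEmbedding_addLeft q)]
    have := integrableOn_upperGamma_integrand (s / 2 - 1) (z := q) (by simpa using hq)
    simpa [Function.comp_def] using this
  have h2 : IntegrableOn (fun t : ℝ => ((q * t : ℝ) : ℂ) ^ (s / 2 - 1) *
      Complex.exp (-((q * t : ℝ) : ℂ))) (Ioi 1) :=
    (integrableOn_Ioi_comp_mul_left_iff
      (fun v : ℝ => (v : ℂ) ^ (s / 2 - 1) * Complex.exp (-v)) 1 hq).2 (by rwa [mul_one])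
  exact IntegrableOn.congr_fun (Integrable.const_mul h2 ((q : ℂ) / (q : ℂ) ^ (s / 2)))
    (fun t ht => integrand_comp_mul s hq (one_pos.trans ht)) measurableSet_Ioi

/-- Taking norms replaces `s` by its real part, so the norm condition for exchanging sum and
integral reduces to `summable_gammaQuotient`. -/
theorem integral_norm_cpow_mul_exp_neg_mul (s : ℂ) {q : ℝ} (hq : 0 < q) :
    ∫ t in Ioi (1 : ℝ), ‖(t : ℂ) ^ (s / 2 - 1) * Complex.exp (-(q * t))‖ =
      ‖gammaQuotient 1 (s.re : ℂ) q‖ := by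
  have h : ∀ t ∈ Ioi (1 : ℝ), (t : ℂ) ^ ((s.re : ℂ) / 2 - 1) * Complex.exp (-(q * t)) =
      ((‖(t : ℂ) ^ (s / 2 - 1) * Complex.exp (-(q * t))‖ : ℝ) : ℂ) := by
    intro t ht
    have ht0 : (0 : ℝ) < t := one_pos.trans ht
    rw [norm_mul, Complex.norm_cpow_eq_rpow_re_of_pos ht0, Complex.norm_exp, Complex.ofReal_mul,
      Complex.ofReal_cpow ht0.le, Complex.ofReal_exp]
    simp
  rw [gammaQuotient_one_eq_integral _ hq, setIntegral_congr_fun measurableSet_Ioi h,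
    integral_complex_ofReal, Complex.norm_real, Real.norm_of_nonneg]
  exact integral_nonneg fun t => norm_nonneg _

theorem tsum_gammaQuotient_one (s : ℂ) :
    ∑' k, gammaQuotient 1 s (sqMulPi k) = ∫ t in Ioi (1 : ℝ), (t : ℂ) ^ (s / 2 - 1) *
      ∑' k, Complex.exp (-(sqMulPi k * t)) := by
  have h := hasSum_integral_of_summable_integral_norm (μ := volume.restrict (Ioi (1 : ℝ)))
    (F := fun k (t : ℝ) => (t : ℂ) ^ (s / 2 - 1) * Complex.exp (-(sqMulPi k * t)))
    (fun k => integrableOn_cpow_mul_exp_neg_mul s (sqMulPi_pos k)) ?_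
  · simp_rw [gammaQuotient_one_eq_integral s (sqMulPi_pos _), h.tsum_eq, tsum_mul_left]
  · simp_rw [integral_norm_cpow_mul_exp_neg_mul s (sqMulPi_pos _)]
    exact (summable_gammaQuotient one_lt_re_one _).norm

theorem tsum_exp_neg_sqMulPi_mul_ofReal {t : ℝ} (ht : 0 < t) :
    ∑' k, Complex.exp (-(sqMulPi k * t)) = ((HurwitzZeta.evenKernel 0 t : ℂ) - 1) / 2 := by
  have h := (Complex.hasSum_ofReal.2 (HurwitzZeta.hasSum_nat_cosKernel₀ 0 ht)).div_const 2
  rw [HurwitzZeta.evenKernel_eq_cosKernel_of_zero]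
  have e : (((HurwitzZeta.cosKernel ((0 : ℝ) : UnitAddCircle) t - 1 : ℝ) : ℂ)) / 2 =
      ((HurwitzZeta.cosKernel 0 t : ℂ) - 1) / 2 := by simp
  rw [← e, ← h.tsum_eq]
  refine tsum_congr fun k => ?_
  rw [sqMulPi]
  push_cast
  simp only [mul_zero, zero_mul, Complex.cos_zero, mul_one]
  rw [mul_div_cancel_left₀ _ two_ne_zero]
  ring_nf

theorem mellin_indicator_f_modif (s : ℂ) :
    mellin ((Ioi 1).indicator (HurwitzZeta.hurwitzEvenFEPair 0).f_modif) (s / 2) =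
      2 * ∑' k, gammaQuotient 1 s (sqMulPi k) := by
  rw [tsum_gammaQuotient_one, mellin, ← integral_const_mul]
  have e : ∀ t : ℝ, (t : ℂ) ^ (s / 2 - 1) •
      (Ioi 1).indicator (HurwitzZeta.hurwitzEvenFEPair 0).f_modif t =
      (Ioi 1).indicator (fun t : ℝ => (t : ℂ) ^ (s / 2 - 1) •
        (HurwitzZeta.hurwitzEvenFEPair 0).f_modif t) t :=
    fun t => (indicator_smul_apply (Ioi (1 : ℝ)) (fun t : ℝ => (t : ℂ) ^ (s / 2 - 1)) _ t).symm
  simp_rw [e]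
  rw [setIntegral_indicator measurableSet_Ioi, Ioi_inter_Ioi, max_eq_right zero_le_one]
  refine setIntegral_congr_fun measurableSet_Ioi fun t ht => ?_
  have ht' : (1 : ℝ) < t := ht
  have e : (HurwitzZeta.hurwitzEvenFEPair 0).f_modif t = HurwitzZeta.evenKernel 0 t - 1 := by
    simp [WeakFEPair.f_modif, ht', not_lt.2 ht'.le, HurwitzZeta.hurwitzEvenFEPair]
  simp only [smul_eq_mul]
  rw [e, tsum_exp_neg_sqMulPi_mul_ofReal (one_pos.trans ht')]
  ring

/-- The pair is self-dual, so its functional equation recovers the kernel on `(0, 1)` from that on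
`(1, ∞)`; at `t = 1` everything is zero. -/
theorem f_modif_eq_indicator_add {t : ℝ} (ht : 0 < t) :
    (HurwitzZeta.hurwitzEvenFEPair 0).f_modif t =
      (Ioi 1).indicator (HurwitzZeta.hurwitzEvenFEPair 0).f_modif t +
        (t : ℂ) ^ (-(1 / 2) : ℂ) •
          (Ioi 1).indicator (HurwitzZeta.hurwitzEvenFEPair 0).f_modif t⁻¹ := by
  set P := HurwitzZeta.hurwitzEvenFEPair 0 with hP
  rcases lt_trichotomy t 1 with h | rfl | h
  · have h' : (1 : ℝ) < t⁻¹ := (one_lt_inv₀ ht).2 h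
    rw [indicator_of_notMem (notMem_Ioi.2 h.le), indicator_of_mem (mem_Ioi.2 h'), zero_add]
    have hg : P.g_modif = P.f_modif := by
      have : P.symm.f_modif = P.f_modif := by rw [hP, HurwitzZeta.hurwitzEvenFEPair_zero_symm]
      exact this
    have key := P.hf_modif_FE t⁻¹ (inv_pos.2 ht)
    have hε : P.ε = 1 := rfl
    have hk : P.k = 1 / 2 := rfl
    rw [one_div, inv_inv, hg, hε, hk, one_mul] at key
    rw [key, Real.inv_rpow ht.le, ← Real.rpow_neg ht.le, Complex.ofReal_cpow ht.le]
    norm_num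
  · simp [WeakFEPair.f_modif]
  · have h' : t⁻¹ ≤ (1 : ℝ) := inv_le_one_of_one_le₀ h.le
    rw [indicator_of_mem (mem_Ioi.2 h), indicator_of_notMem (notMem_Ioi.2 h'), smul_zero, add_zero]

/-- The substitution `t ↦ 1/t` with weight `t^(-1/2)` turns the integral over `(0, 1)` at `s/2` into
the one over `(1, ∞)` at `(1-s)/2`. -/
theorem completedRiemannZeta₀_eq_gammaSeries_one (s : ℂ) :
    completedRiemannZeta₀ s = gammaSeries 1 s := by
  set P := HurwitzZeta.hurwitzEvenFEPair 0 with hP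
  set h := (Ioi (1 : ℝ)).indicator P.f_modif with hh
  have hconv : ∀ s, MellinConvergent h s := by
    intro s
    have := (P.isStrongFEPair_toStrongFEPair.hasMellin s).1
    have h2 : IntegrableOn ((Ioi (1 : ℝ)).indicator
        fun t : ℝ => (t : ℂ) ^ (s - 1) • P.f_modif t) (Ioi 0) :=
      Integrable.indicator this measurableSet_Ioi
    rw [indicator_smul] at h2
    exact h2
  have hconv' : ∀ s, MellinConvergent (fun t : ℝ => (t : ℂ) ^ (-(1 / 2) : ℂ) • h t⁻¹) s := by
    intro s
    rw [MellinConvergent.cpow_smul]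
    have := (MellinConvergent.comp_rpow (f := h) (s := s + -(1 / 2)) (a := -1) (by norm_num)).2
      (hconv _)
    simpa only [Real.rpow_neg_one] using this
  have e1 : mellin P.f_modif (s / 2) = mellin h (s / 2) + mellin h ((1 - s) / 2) := by
    have e2 : mellin P.f_modif (s / 2) =
        mellin (fun t : ℝ => h t + (t : ℂ) ^ (-(1 / 2) : ℂ) • h t⁻¹) (s / 2) := by
      refine setIntegral_congr_fun measurableSet_Ioi fun t ht => ?_
      simp only
      rw [f_modif_eq_indicator_add ht]
    rw [e2, (hasMellin_add (hconv _) (hconv' _)).2, mellin_cpow_smul, mellin_comp_inv]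
    ring_nf
  have e3 : completedRiemannZeta₀ s = mellin P.f_modif (s / 2) / 2 := rfl
  rw [e3, e1, hh, mellin_indicator_f_modif, mellin_indicator_f_modif, gammaSeries, one_div_one]
  ring

/-! ### Constancy in `x` -/

/-- The antiderivative of `x ^ (s - 1)` which vanishes at `x = 1`. -/
noncomputable def cpowPrimitive (x s : ℂ) : ℂ :=
  if s = 0 then Complex.log x else (x ^ s - 1) / s

theorem mul_cpowPrimitive {x : ℂ} (s : ℂ) : s * cpowPrimitive x s = x ^ s - 1 := by
  rw [cpowPrimitive]
  split_ifs with h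
  · simp [h]
  · rw [mul_div_cancel₀ _ h]

theorem hasDerivAt_cpowPrimitive {x : ℂ} (hx : x ∈ Complex.slitPlane) (s : ℂ) :
    HasDerivAt (fun x => cpowPrimitive x s) (x ^ (s - 1)) x := by
  unfold cpowPrimitive
  split_ifs with h
  · simpa [h, Complex.cpow_neg_one] using Complex.hasDerivAt_log hx
  · refine ((((hasDerivAt_id x).cpow_const (c := s) hx).sub_const 1).div_const s).congr_deriv ?_
    simp only [id, mul_one]
    rw [mul_div_cancel_left₀ _ h]

theorem convex_setOf_abs_im_lt_re : Convex ℝ {x : ℂ | |x.im| < x.re} := by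
  intro x hx y hy a b ha hb hab
  simp only [mem_ofPred_eq, Complex.add_im, Complex.add_re, Complex.smul_im, Complex.smul_re,
    smul_eq_mul, abs_lt] at hx hy ⊢
  rcases ha.eq_or_lt with rfl | ha'
  · rw [zero_add] at hab
    subst hab
    simpa using hy
  · constructor <;> nlinarith

theorem gammaSeries_sub_cpowPrimitive {x : ℂ} (hx : |x.im| < x.re) (s : ℂ) :
    gammaSeries x s - cpowPrimitive x s + cpowPrimitive x (s - 1) = completedRiemannZeta₀ s := by
  have hd : ∀ y ∈ {x : ℂ | |x.im| < x.re}, HasDerivAt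
      (fun x => gammaSeries x s - cpowPrimitive x s + cpowPrimitive x (s - 1)) 0 y := by
    intro y hy
    have hs : y ∈ Complex.slitPlane := Or.inl (re_pos_of_abs_im_lt_re hy)
    refine (((hasDerivAt_gammaSeries hy s).sub (hasDerivAt_cpowPrimitive hs s)).add
      (hasDerivAt_cpowPrimitive hs (s - 1))).congr_deriv ?_
    ring
  have key := convex_setOf_abs_im_lt_re.norm_image_sub_le_of_norm_hasDerivWithin_le (𝕜 := ℂ)
    (C := 0) (fun y hy => (hd y hy).hasDerivWithinAt) (fun y _ => by simp) one_lt_re_one hx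
  rw [zero_mul, norm_le_zero_iff, sub_eq_zero] at key
  rw [completedRiemannZeta₀_eq_gammaSeries_one, key]
  simp [cpowPrimitive]

/-! ### From the completed zeta function to the product, and limits at exceptional points -/

theorem zetaGamma_of_isRegularPoint {s : ℂ} (hs : IsRegularPoint s) :
    zetaGamma s = completedRiemannZeta s := by
  have hs0 : s ≠ 0 := by simpa using hs.2 0
  have hG : Complex.Gammaℝ s ≠ 0 := fun h => by
    obtain ⟨n, hn⟩ := Complex.Gammaℝ_eq_zero_iff.1 h
    exact hs.2 n hn
  have e : zetaGamma s = riemannZeta s * Complex.Gammaℝ s := by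
    rw [zetaGamma, Complex.Gammaℝ_def, neg_div, Complex.cpow_neg]
    ring
  rw [e, riemannZeta_def_of_ne_zero hs0, div_mul_cancel₀ _ hG]

theorem mul_sub_one_mul_zetaGamma {s : ℂ} (hs : IsRegularPoint s) :
    s * (s - 1) * zetaGamma s = s * (s - 1) * completedRiemannZeta₀ s + 1 := by
  have hs0 : s ≠ 0 := by simpa using hs.2 0
  have hs1 : 1 - s ≠ 0 := sub_ne_zero.2 hs.1.symm
  rw [zetaGamma_of_isRegularPoint hs, completedRiemannZeta_eq]
  field_simp
  ring

/-- The poles of `Gammaℝ` are zeros of its entire reciprocal, which is nonzero at `1`; hence they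
are isolated. -/
theorem eventually_isRegularPoint (s : ℂ) : ∀ᶠ w in 𝓝[≠] s, IsRegularPoint w := by
  have h1 : ∀ᶠ w in 𝓝[≠] s, w ≠ 1 := by
    by_cases h : s = 1
    · rw [h]; exact self_mem_nhdsWithin
    · exact (eventually_ne_nhds h).filter_mono nhdsWithin_le_nhds
  have han : AnalyticOnNhd ℂ (fun s => (Complex.Gammaℝ s)⁻¹) univ :=
    Complex.differentiable_Gammaℝ_inv.differentiableOn.analyticOnNhd isOpen_univ
  have h2 : ∀ᶠ w in 𝓝[≠] s, (Complex.Gammaℝ w)⁻¹ ≠ 0 := by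
    refine ((han s (mem_univ s)).eventually_eq_zero_or_eventually_ne_zero).resolve_left fun h => ?_
    have := han.eqOn_zero_of_preconnected_of_eventuallyEq_zero isPreconnected_univ
      (mem_univ s) h (mem_univ 1)
    simp [Complex.Gammaℝ_one] at this
  filter_upwards [h1, h2] with w hw1 hw2
  exact ⟨hw1, fun n hn => hw2 (inv_eq_zero.2 (Complex.Gammaℝ_eq_zero_iff.2 ⟨n, hn⟩))⟩

theorem tendsto_mul_sub_one_mul_zetaGamma (s : ℂ) :
    Tendsto (fun w : ℂ => w * (w - 1) * zetaGamma w) (𝓝[≠] s)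
      (𝓝 (s * (s - 1) * completedRiemannZeta₀ s + 1)) := by
  have hc : Continuous fun w : ℂ => w * (w - 1) * completedRiemannZeta₀ w + 1 := by
    have := differentiable_completedZeta₀.continuous
    fun_prop
  refine ((hc.tendsto s).mono_left nhdsWithin_le_nhds).congr' ?_
  filter_upwards [eventually_isRegularPoint s] with w hw
  exact (mul_sub_one_mul_zetaGamma hw).symm

/-! ### The representation with a parameter; continuity in `s` -/

theorem gammaTerm_succ (x s : ℂ) (k : ℕ) :
    gammaTerm x s (k + 1) =
      gammaQuotient x s (sqMulPi k) + gammaQuotient (1 / x) (1 - s) (sqMulPi k) := by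
  rw [gammaTerm, gammaQuotient, gammaQuotient, sqMulPi]
  push_cast
  congr 3 <;> ring

theorem hasSum_gammaTerm {x : ℂ} (hx : |x.im| < x.re) (s : ℂ) :
    HasSum (fun k => gammaTerm x s (k + 1)) (gammaSeries x s) := by
  simp_rw [gammaTerm_succ]
  exact (summable_gammaQuotient hx s).hasSum.add
    (summable_gammaQuotient (abs_im_inv_lt_re_inv hx) (1 - s)).hasSum

theorem boundary_add_mul_gammaSeries {x : ℂ} (hx : |x.im| < x.re) (s : ℂ) :
    (1 - s) * x ^ s + s * x ^ (s - 1) + s * (s - 1) * gammaSeries x s =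
      s * (s - 1) * completedRiemannZeta₀ s + 1 := by
  rw [← gammaSeries_sub_cpowPrimitive hx s]
  linear_combination (s - 1) * mul_cpowPrimitive (x := x) s -
    s * mul_cpowPrimitive (x := x) (s - 1)

theorem continuous_cpowPrimitive {x : ℂ} (hx : x ≠ 0) : Continuous (cpowPrimitive x) := by
  have hd : ∀ w, HasDerivAt (fun w : ℂ => x ^ w) (x ^ w * Complex.log x) w := fun w => by
    simpa using (hasDerivAt_id w).const_cpow (c := x) (Or.inl hx)
  -- The primitive is the difference quotient of `w ↦ x ^ w` at `0`, with `log x` filling the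
  -- removable singularity.
  have e : cpowPrimitive x = dslope (fun w : ℂ => x ^ w) 0 := by
    ext w
    by_cases h : w = 0
    · rw [h, dslope_same, (hd 0).deriv]
      simp [cpowPrimitive]
    · rw [dslope_of_ne _ h, slope_def_field, cpowPrimitive, if_neg h]
      simp
  rw [e, continuous_iff_continuousAt]
  intro w
  by_cases h : w = 0
  · rw [h, continuousAt_dslope_same]
    exact (hd 0).differentiableAt
  · rw [continuousAt_dslope_of_ne h]
    exact (hd w).continuousAt

theorem continuous_gammaSeries {x : ℂ} (hx : |x.im| < x.re) :
    Continuous fun s => gammaSeries x s := by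
  have e : ∀ s, gammaSeries x s =
      completedRiemannZeta₀ s + cpowPrimitive x s - cpowPrimitive x (s - 1) := fun s => by
    rw [← gammaSeries_sub_cpowPrimitive hx s]; ring
  simp_rw [e]
  have h1 := differentiable_completedZeta₀.continuous
  have h2 := continuous_cpowPrimitive (ne_zero_of_abs_im_lt_re hx)
  fun_prop

/-! ### The representation by second differences -/

theorem ofReal_mul_cpow {x : ℂ} (hx : x ≠ 0) {c : ℝ} (hc : 0 < c) (s : ℂ) :
    ((c : ℂ) * x) ^ s = (c : ℂ) ^ s * x ^ s := by
  have hc0 : (c : ℂ) ≠ 0 := Complex.ofReal_ne_zero.2 hc.ne'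
  rw [Complex.cpow_def_of_ne_zero (mul_ne_zero hc0 hx), Complex.cpow_def_of_ne_zero hc0,
    Complex.cpow_def_of_ne_zero hx, Complex.log_ofReal_mul hc hx, Complex.ofReal_log hc.le,
    ← Complex.exp_add]
  ring_nf

theorem gammaQuotient_sq_mul (x s : ℂ) {c q : ℝ} (hc : 0 < c) (hq : 0 < q) :
    gammaQuotient x s (c ^ 2 * q) = (c : ℂ) ^ (-s) * gammaQuotient (c * x) s q := by
  have h := ofReal_mul_sq_cpow (x := (c : ℂ)) (by simpa using hc) hq (s / 2)
  rw [mul_div_cancel₀ s two_ne_zero] at h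
  rw [gammaQuotient, gammaQuotient, Complex.cpow_neg]
  push_cast
  rw [mul_comm ((c : ℂ) ^ 2) q, h, mul_assoc, mul_pow, mul_comm ((q : ℂ) ^ (s / 2)), ← div_div]
  ring

theorem upsilonPart_succ (x s : ℂ) (k : ℕ) :
    upsilonPart x s (k + 1) = 2 ^ s * gammaQuotient (x / 2) s (sqMulPi k) := by
  have h := gammaQuotient_sq_mul x s (c := 1 / 2) (by norm_num) (sqMulPi_pos k)
  have e1 : (((1 / 2 : ℝ) : ℂ)) ^ (-s) = 2 ^ s := by
    have : (2 : ℂ).arg ≠ Real.pi := by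
      rw [Complex.ofNat_arg]; exact Real.pi_ne_zero.symm
    push_cast
    rw [one_div, Complex.inv_cpow _ _ this, Complex.cpow_neg, inv_inv]
  have e2 : ((1 / 2 : ℝ) : ℂ) * x = x / 2 := by push_cast; ring
  rw [e1, e2] at h
  rw [← h, upsilonPart, gammaQuotient, sqMulPi]
  push_cast
  congr 2 <;> ring

theorem upsilonPart_two_mul_succ (x s : ℂ) (k : ℕ) :
    upsilonPart x s (2 * (k + 1)) = gammaQuotient x s (sqMulPi k) := by
  rw [upsilonPart, gammaQuotient, sqMulPi]
  push_cast
  congr 2 <;> ring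

theorem upsilonPart_four_mul_succ (x s : ℂ) (k : ℕ) :
    upsilonPart x s (4 * (k + 1)) = 2 ^ (-s) * gammaQuotient (2 * x) s (sqMulPi k) := by
  have h := gammaQuotient_sq_mul x s (c := 2) (by norm_num) (sqMulPi_pos k)
  push_cast at h
  rw [← h, upsilonPart, gammaQuotient, sqMulPi]
  push_cast
  congr 2 <;> ring

theorem abs_im_div_two_lt {x : ℂ} (hx : |x.im| < x.re) : |(x / 2).im| < (x / 2).re := by
  have := abs_im_ofReal_mul_lt hx (c := 1 / 2) (by norm_num)
  have e : ((1 / 2 : ℝ) : ℂ) * x = x / 2 := by push_cast; ring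
  rwa [e] at this

theorem abs_im_two_mul_lt {x : ℂ} (hx : |x.im| < x.re) : |(2 * x).im| < (2 * x).re := by
  simpa using abs_im_ofReal_mul_lt hx (c := 2) (by norm_num)

/-- Let `A`, `B`, `C` be the sums over all `m ≥ 1`, over even `m` and over multiples of `4`. The odd
`m` give `A - B` and `m ≡ 2 mod 4` gives `B - C`, whence `A - 3B + 2C`; rescaling turns these into
series at `x/2`, `x`, `2x`. -/
theorem hasSum_upsilonTerm {x : ℂ} (hx : |x.im| < x.re) (s : ℂ) :
    HasSum (upsilonTerm x s) (2 ^ s * ∑' k, gammaQuotient (x / 2) s (sqMulPi k) -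
      3 * ∑' k, gammaQuotient x s (sqMulPi k) +
      2 * (2 ^ (-s) * ∑' k, gammaQuotient (2 * x) s (sqMulPi k))) := by
  have h1 : HasSum (fun k => upsilonPart x s (k + 1)) _ :=
    (((summable_gammaQuotient (abs_im_div_two_lt hx) s).hasSum.mul_left (2 ^ s)).congr_fun
      fun k => upsilonPart_succ x s k)
  have h2 : HasSum (fun k => upsilonPart x s (2 * (k + 1))) _ :=
    ((summable_gammaQuotient hx s).hasSum.congr_fun fun k => upsilonPart_two_mul_succ x s k)
  have h4 : HasSum (fun k => upsilonPart x s (4 * (k + 1))) _ :=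
    (((summable_gammaQuotient (abs_im_two_mul_lt hx) s).hasSum.mul_left (2 ^ (-s))).congr_fun
      fun k => upsilonPart_four_mul_succ x s k)
  have hr : ∀ r : ℕ, Summable fun k => upsilonPart x s (4 * k + r + 1) := fun r =>
    h1.summable.comp_injective (i := fun k => 4 * k + r) fun k l h => by simpa using h
  have s1 := (hr 0).hasSum
  have s2 := (hr 1).hasSum
  have s3 := (hr 2).hasSum
  have odd : HasSum (fun k => upsilonPart x s (2 * k + 1)) _ :=
    HasSum.even_add_odd (f := fun k => upsilonPart x s (2 * k + 1))
      (s1.congr_fun fun k => by ring_nf) (s3.congr_fun fun k => by ring_nf)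
  have u1 := (HasSum.even_add_odd (f := fun k => upsilonPart x s (k + 1)) odd
    (h2.congr_fun fun k => by ring_nf)).unique h1
  have u2 := (HasSum.even_add_odd (f := fun k => upsilonPart x s (2 * (k + 1)))
    (s2.congr_fun fun k => by ring_nf) (h4.congr_fun fun k => by ring_nf)).unique h2
  have := (s1.sub (s2.mul_left (2 : ℂ))).add s3
  refine (congrArg (fun a => HasSum (upsilonTerm x s) a) ?_).mpr this
  linear_combination -u1 + 2 * u2

/-- Under `(x, s) ↦ (1/x, 1-s)` the roles of `x/2` and `2x` are exchanged, and so are `2^s` and `2 *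
2^(-s)`. -/
theorem upsilon_add_upsilon {x : ℂ} (hx : |x.im| < x.re) (s : ℂ) :
    upsilon x s + upsilon (1 / x) (1 - s) = 2 ^ s * gammaSeries (x / 2) s -
      3 * gammaSeries x s + 2 ^ (1 - s) * gammaSeries (2 * x) s := by
  rw [upsilon, upsilon, (hasSum_upsilonTerm hx s).tsum_eq,
    (hasSum_upsilonTerm (abs_im_inv_lt_re_inv hx) (1 - s)).tsum_eq, gammaSeries, gammaSeries,
    gammaSeries, show 1 / x / 2 = 1 / (2 * x) by ring, show 2 * (1 / x) = 1 / (x / 2) by ring,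
    show -(1 - s) = s - 1 by ring, Complex.cpow_sub _ 1 two_ne_zero,
    Complex.cpow_sub 1 _ two_ne_zero, Complex.cpow_neg, Complex.cpow_one]
  ring

theorem mul_zetaGamma_eq_upsilon_add {x : ℂ} (hx : |x.im| < x.re) {s : ℂ}
    (hs : IsRegularPoint s) :
    ((2 : ℂ) ^ s - 1) * (1 - (2 : ℂ) ^ (1 - s)) * zetaGamma s =
      upsilon x s + upsilon (1 / x) (1 - s) := by
  have hs0 : s ≠ 0 := by simpa using hs.2 0
  have hx0 := ne_zero_of_abs_im_lt_re hx
  have h2s : (2 : ℂ) ^ s ≠ 0 := by simp [Complex.cpow_eq_zero_iff]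
  have hz := mul_sub_one_mul_zetaGamma hs
  have b1 := boundary_add_mul_gammaSeries (abs_im_div_two_lt hx) s
  have b2 := boundary_add_mul_gammaSeries hx s
  have b3 := boundary_add_mul_gammaSeries (abs_im_two_mul_lt hx) s
  rw [← hz] at b1 b2 b3
  have p1 : ∀ w : ℂ, x ^ w = 2 ^ w * (x / 2) ^ w := fun w => by
    have hx2 : x / 2 ≠ 0 := div_ne_zero hx0 two_ne_zero
    have := ofReal_mul_cpow hx2 (c := 2) two_pos w
    push_cast at this
    rwa [mul_div_cancel₀ _ two_ne_zero] at this
  have p2 : ∀ w : ℂ, (2 * x) ^ w = 2 ^ w * x ^ w := fun w => by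
    simpa using ofReal_mul_cpow hx0 (c := 2) two_pos w
  have q1 := p1 s
  have q2 := p1 (s - 1)
  rw [p2, p2] at b3
  have c1 : (2 : ℂ) ^ s = 2 * 2 ^ (s - 1) := by
    rw [Complex.cpow_sub _ 1 two_ne_zero, Complex.cpow_one]; ring
  have c2 : (2 : ℂ) ^ (1 - s) * 2 ^ (s - 1) = 1 := by
    rw [← Complex.cpow_add _ _ two_ne_zero]; simp
  rw [upsilon_add_upsilon hx]
  refine mul_left_cancel₀ (mul_ne_zero hs0 (sub_ne_zero.2 hs.1)) ?_
  -- The boundary terms vanish because the coefficients of `x^s` are `1 - 3 + 2` and those of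
  -- `x^(s-1)` are `2 - 3 + 1`.
  linear_combination (-2 ^ s) * b1 + 3 * b2 - 2 ^ (1 - s) * b3 +
    (1 - s) * (-q1 + (2 * c2 + 2 ^ (1 - s) * c1) * x ^ s) +
    s * (c1 * (x / 2) ^ (s - 1) - 2 * q2 + c2 * x ^ (s - 1)) -
    s * (s - 1) * zetaGamma s * (2 ^ (1 - s) * c1 + 2 * c2)

theorem tendsto_mul_zetaGamma_upsilon {x : ℂ} (hx : |x.im| < x.re) (s : ℂ) :
    Tendsto (fun w : ℂ => ((2 : ℂ) ^ w - 1) * (1 - (2 : ℂ) ^ (1 - w)) * zetaGamma w)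
      (𝓝[≠] s) (𝓝 (upsilon x s + upsilon (1 / x) (1 - s))) := by
  have hc : Continuous fun w : ℂ => upsilon x w + upsilon (1 / x) (1 - w) := by
    simp_rw [upsilon_add_upsilon hx]
    have h1 := continuous_gammaSeries (abs_im_div_two_lt hx)
    have h2 := continuous_gammaSeries hx
    have h3 := continuous_gammaSeries (abs_im_two_mul_lt hx)
    have h4 : Continuous fun w : ℂ => (2 : ℂ) ^ w := by
      simpa using continuous_id.const_cpow (b := (2 : ℂ)) (Or.inl two_ne_zero)
    have h5 : Continuous fun w : ℂ => (2 : ℂ) ^ (1 - w) :=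
      h4.comp (continuous_const.sub continuous_id)
    fun_prop
  refine ((hc.tendsto s).mono_left nhdsWithin_le_nhds).congr' ?_
  filter_upwards [eventually_isRegularPoint s] with w hw
  exact (mul_zetaGamma_eq_upsilon_add hx hw).symm

/-! ### The three representations -/

theorem theorem3 :
    -- the first representation
    (∀ s : ℂ,
      Summable (fun k : ℕ =>
        upperGamma (s / 2) (((k + 1 : ℕ) : ℂ) ^ 2 * Real.pi) /
            (((k + 1 : ℕ) : ℂ) ^ 2 * Real.pi) ^ (s / 2) +
          upperGamma ((1 - s) / 2) (((k + 1 : ℕ) : ℂ) ^ 2 * Real.pi) /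
            (((k + 1 : ℕ) : ℂ) ^ 2 * Real.pi) ^ ((1 - s) / 2)) ∧
      (IsRegularPoint s →
        s * (s - 1) * zetaGamma s = 1 - s * (1 - s) * ∑' k : ℕ,
          (upperGamma (s / 2) (((k + 1 : ℕ) : ℂ) ^ 2 * Real.pi) /
              (((k + 1 : ℕ) : ℂ) ^ 2 * Real.pi) ^ (s / 2) +
            upperGamma ((1 - s) / 2) (((k + 1 : ℕ) : ℂ) ^ 2 * Real.pi) /
              (((k + 1 : ℕ) : ℂ) ^ 2 * Real.pi) ^ ((1 - s) / 2))) ∧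
      Tendsto (fun w : ℂ => w * (w - 1) * zetaGamma w) (𝓝[≠] s)
        (𝓝 (1 - s * (1 - s) * ∑' k : ℕ,
          (upperGamma (s / 2) (((k + 1 : ℕ) : ℂ) ^ 2 * Real.pi) /
              (((k + 1 : ℕ) : ℂ) ^ 2 * Real.pi) ^ (s / 2) +
            upperGamma ((1 - s) / 2) (((k + 1 : ℕ) : ℂ) ^ 2 * Real.pi) /
              (((k + 1 : ℕ) : ℂ) ^ 2 * Real.pi) ^ ((1 - s) / 2))))) ∧
    -- the representation with a parameter
    (∀ x : ℂ, |x.im| < x.re → ∀ s : ℂ,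
      Summable (fun k : ℕ => gammaTerm x s (k + 1)) ∧
      (IsRegularPoint s →
        s * (s - 1) * zetaGamma s =
          (1 - s) * x ^ s + s * x ^ (s - 1) +
            s * (s - 1) * ∑' k : ℕ, gammaTerm x s (k + 1)) ∧
      Tendsto (fun w : ℂ => w * (w - 1) * zetaGamma w) (𝓝[≠] s)
        (𝓝 ((1 - s) * x ^ s + s * x ^ (s - 1) +
          s * (s - 1) * ∑' k : ℕ, gammaTerm x s (k + 1)))) ∧
    -- the representation by second differences
    (∀ x : ℂ, |x.im| < x.re → ∀ s : ℂ,
      Summable (upsilonTerm x s) ∧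
      Summable (upsilonTerm (1 / x) (1 - s)) ∧
      (IsRegularPoint s →
        ((2 : ℂ) ^ s - 1) * (1 - (2 : ℂ) ^ (1 - s)) * zetaGamma s =
          upsilon x s + upsilon (1 / x) (1 - s)) ∧
      Tendsto (fun w : ℂ => ((2 : ℂ) ^ w - 1) * (1 - (2 : ℂ) ^ (1 - w)) * zetaGamma w)
        (𝓝[≠] s) (𝓝 (upsilon x s + upsilon (1 / x) (1 - s)))) := by
  have hone : ∀ (s : ℂ) (k : ℕ),
      upperGamma (s / 2) (((k + 1 : ℕ) : ℂ) ^ 2 * Real.pi) /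
          (((k + 1 : ℕ) : ℂ) ^ 2 * Real.pi) ^ (s / 2) +
        upperGamma ((1 - s) / 2) (((k + 1 : ℕ) : ℂ) ^ 2 * Real.pi) /
          (((k + 1 : ℕ) : ℂ) ^ 2 * Real.pi) ^ ((1 - s) / 2) = gammaTerm 1 s (k + 1) := by
    intro s k
    simp [gammaTerm]
  refine ⟨fun s => ?_, fun x hx s => ?_, fun x hx s => ?_⟩
  · simp_rw [hone]
    have hB := hasSum_gammaTerm one_lt_re_one s
    have e : 1 - s * (1 - s) * gammaSeries 1 s =
        s * (s - 1) * completedRiemannZeta₀ s + 1 := by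
      rw [completedRiemannZeta₀_eq_gammaSeries_one]; ring
    rw [hB.tsum_eq, e]
    exact ⟨hB.summable, mul_sub_one_mul_zetaGamma, tendsto_mul_sub_one_mul_zetaGamma s⟩
  · have hB := hasSum_gammaTerm hx s
    rw [hB.tsum_eq, boundary_add_mul_gammaSeries hx]
    exact ⟨hB.summable, mul_sub_one_mul_zetaGamma, tendsto_mul_sub_one_mul_zetaGamma s⟩
  · exact ⟨(hasSum_upsilonTerm hx s).summable,
      (hasSum_upsilonTerm (abs_im_inv_lt_re_inv hx) (1 - s)).summable,
      mul_zetaGamma_eq_upsilon_add hx, tendsto_mul_zetaGamma_upsilon hx s⟩
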